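/- Let $\mathbb{F}$ be a field, let $\mathsf{Vec}_{\mathbb{F}}$ be the category of $\mathbb{F}$-vector spaces, and regard $[0,\infty]^2$ with the product order as a category. Let $F\colon [0,\infty]^2 \to \mathsf{Vec}_{\mathbb{F}}$ be a functor that is pointwise finite-dimensional (every $F(x)$ is finite-dimensional) and middle-exact: for all $x,y \in [0,\infty]^2$ the sequence $$F(x\wedge y) \longrightarrow F(x)\oplus F(y) \longrightarrow F(x\vee y),$$ whose first map has as components the two structure maps of $F$ and whose second map is the difference of the two structure maps, is exact at $F(x)\oplus F(y)$. An interval in a poset $P$ is a subset $I\subseteq P$ that is convex ($x,y\in I$ and $x\le z\le y$ imply $z\in I$) and in which any two points are joined by a finite zigzag of comparable points of $I$. Its interval module $\mathbb{F}_I\colon P\to\mathsf{Vec}_{\mathbb{F}}$ has value $\mathbb{F}$ at the points of $I$ and $0$ elsewhere, and its structure map $\mathbb{F}_I(x\le y)$ is $\mathrm{id}_{\mathbb{F}}$ if $x,y\in I$ and $0$ otherwise. A block is an interval $I\subseteq[0,\infty]^2$ of one of the following forms: - $I=J_1\times J_2$ with $J_1,J_2\subseteq[0,\infty]$ down-closed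 (death block); - $I=J_1\times J_2$ with $J_1,J_2\subseteq[0,\infty]$ up-closed (birth block); - $I=J\times[0,\infty]$ with $J\subseteq[0,\infty]$ an interval (vertical block); - $I=[0,\infty]\times J$ with $J\subseteq[0,\infty]$ an interval (horizontal block). Then $F$ decomposes into a direct sum of interval modules over blocks: there is a family $(B_i)_{i\in\iota}$ of blocks (repetitions allowed) such that $$F\;\cong\;\bigoplus_{i\in\iota}\mathbb{F}_{B_i}.$$ -/

import Mathlib

universe u

open CategoryTheory CategoryTheory.Limits

open scoped ENNReal

noncomputable section

/-- A persistence module over a poset `P`: a functor from `P`, viewed as a category through its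
order, to vector spaces over `K`. -/
abbrev PersistenceModule (K : Type u) [Field K] (P : Type) [PartialOrder P] : Type (max 0 (u + 1)) :=
  @Functor P (Preorder.smallCategory P) (ModuleCat.{u} K) _

/-- Pointwise finite-dimensional persistence modules. -/
def IsPointwiseFiniteDimensional {K : Type u} [Field K] {P : Type} [PartialOrder P]
    (F : PersistenceModule K P) : Prop :=
  ∀ x : P, FiniteDimensional K (F.obj x)

/-- A commuting square (top `α : A ⟶ B`, left `f : A ⟶ C`, right `g : B ⟶ D`, bottom
`β : C ⟶ D`) in an abelian category is middle-exact if its associated complex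
`A ⟶ B ⊞ C ⟶ D`, with maps `(α, f)` and `(g, -β)`, is exact. -/
def MiddleExactSquare {𝒜 : Type*} [Category 𝒜] [Abelian 𝒜] {A B C D : 𝒜}
    {α : A ⟶ B} {f : A ⟶ C} {g : B ⟶ D} {β : C ⟶ D} (sq : CommSq α f g β) : Prop :=
  (ShortComplex.mk (biprod.lift α f) (biprod.desc g (-β)) (by simp [sq.w])).Exact

/-- The commuting square `F (x ⊓ y) ⟶ F x`, `F (x ⊓ y) ⟶ F y`, `F x ⟶ F (x ⊔ y)`,
`F y ⟶ F (x ⊔ y)`. -/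
theorem PersistenceModule.infSupSquare {K : Type u} [Field K] {P : Type} [Lattice P]
    (F : PersistenceModule K P) (x y : P) :
    CommSq (F.map (homOfLE (inf_le_left : x ⊓ y ≤ x))) (F.map (homOfLE (inf_le_right : x ⊓ y ≤ y)))
      (F.map (homOfLE (le_sup_left : x ≤ x ⊔ y))) (F.map (homOfLE (le_sup_right : y ≤ x ⊔ y))) :=
  ⟨by rw [← F.map_comp, ← F.map_comp]; rfl⟩

/-- A bipersistence module over `S × T` (with the product order) is middle-exact if for all
`x, y` the square on `x ⊓ y, x, y, x ⊔ y` is sent to a middle-exact square. -/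
def IsMiddleExact {K : Type u} [Field K] {S T : Type} [LinearOrder S] [LinearOrder T]
    (F : PersistenceModule K (S × T)) : Prop :=
  ∀ x y : S × T, MiddleExactSquare (F.infSupSquare x y)

/-- An interval in a poset: a convex subset in which any two points are joined by a finite
zigzag of comparable points of the subset. -/
structure IsInterval {P : Type} [PartialOrder P] (I : Set P) : Prop where
  convex : ∀ ⦃x y z : P⦄, x ∈ I → y ∈ I → x ≤ z → z ≤ y → z ∈ I
  connected : ∀ x y : I, Relation.ReflTransGen (fun a b : I => a ≤ b ∨ b ≤ a) x y

open Classical in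
/-- The interval module of `I`: it is `K` on `I` and `0` off `I`; the map from `x` to `y` is the
identity of `K` if both points lie in `I`, and `0` otherwise. -/
def intervalModule (K : Type u) [Field K] {P : Type} [PartialOrder P] {I : Set P}
    (hI : IsInterval I) : PersistenceModule K P where
  obj x := if x ∈ I then ModuleCat.of K K else ModuleCat.of K PUnit
  map {x y} _ := if h : x ∈ I ∧ y ∈ I then
      eqToHom (if_pos h.1) ≫ 𝟙 (ModuleCat.of K K) ≫ eqToHom (if_pos h.2).symm
    else 0
  map_id x := by
    by_cases hx : x ∈ I
    · simp [hx]
    · rw [dif_neg (fun h => hx h.1)]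
      refine (IsZero.eq_of_src ?_ _ _)
      rw [if_neg hx]
      exact ModuleCat.isZero_of_subsingleton _
  map_comp {x y z} f g := by
    by_cases hx : x ∈ I
    · by_cases hz : z ∈ I
      · have hy : y ∈ I := hI.convex hx hz (leOfHom f) (leOfHom g)
        simp [hx, hy, hz]
      · simp [hz]
    · simp [hx]

/-- Death blocks: products of two down-closed subsets of `[0, ∞]`. -/
def IsDeathBlock (I : Set (ℝ≥0∞ × ℝ≥0∞)) : Prop :=
  ∃ J₁ J₂ : Set ℝ≥0∞, IsLowerSet J₁ ∧ IsLowerSet J₂ ∧ I = J₁ ×ˢ J₂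

/-- Birth blocks: products of two up-closed subsets of `[0, ∞]`. -/
def IsBirthBlock (I : Set (ℝ≥0∞ × ℝ≥0∞)) : Prop :=
  ∃ J₁ J₂ : Set ℝ≥0∞, IsUpperSet J₁ ∧ IsUpperSet J₂ ∧ I = J₁ ×ˢ J₂

/-- Vertical blocks `J × [0, ∞]`, with `J` an interval. -/
def IsVerticalBlock (I : Set (ℝ≥0∞ × ℝ≥0∞)) : Prop :=
  ∃ J : Set ℝ≥0∞, IsInterval J ∧ I = J ×ˢ (Set.univ : Set ℝ≥0∞)

/-- Horizontal blocks `[0, ∞] × J`, with `J` an interval. -/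
def IsHorizontalBlock (I : Set (ℝ≥0∞ × ℝ≥0∞)) : Prop :=
  ∃ J : Set ℝ≥0∞, IsInterval J ∧ I = (Set.univ : Set ℝ≥0∞) ×ˢ J

/-- A block is an interval in `[0, ∞]²` of one of the four types above. -/
structure IsBlock (I : Set (ℝ≥0∞ × ℝ≥0∞)) : Prop where
  isInterval : IsInterval I
  cases : IsDeathBlock I ∨ IsBirthBlock I ∨ IsVerticalBlock I ∨ IsHorizontalBlock I

end

/-! ### Adapted vectors and functionals; functionals on direct limits. -/

section LinearAlgebra

variable {K V : Type*} [Field K] [AddCommGroup V] [Module K V]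

/-- Two chains of subspaces admit a vector and a functional adapted to both. -/
theorem exists_vector_functional_of_isChain [FiniteDimensional K V] [Nontrivial V]
    {𝒜 ℬ : Set (Submodule K V)} (h𝒜 : IsChain (· ≤ ·) 𝒜) (hℬ : IsChain (· ≤ ·) ℬ) :
    ∃ (v : V) (φ : Module.Dual K V), φ v = 1 ∧
      ∀ U, U ∈ 𝒜 ∨ U ∈ ℬ → v ∈ U ∨ ∀ x ∈ U, φ x = 0 := by
  -- `A` is the least nonzero member of the first chain, and `B` the least member of the second that
  -- meets `A` nontrivially; `⊤` stands in when there is none. The vector is taken in `A ⊓ B`.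
  obtain ⟨A, ⟨hA, hA0⟩, hAmin⟩ := wellFounded_lt.has_min
    {U : Submodule K V | (U ∈ 𝒜 ∨ U = ⊤) ∧ U ≠ ⊥} ⟨⊤, Or.inr rfl, top_ne_bot⟩
  obtain ⟨B, ⟨hB, hB0⟩, hBmin⟩ := wellFounded_lt.has_min
    {U : Submodule K V | (U ∈ ℬ ∨ U = ⊤) ∧ A ⊓ U ≠ ⊥} ⟨⊤, Or.inr rfl, by simpa using hA0⟩
  obtain ⟨v, ⟨hvA, hvB⟩, hv0⟩ := (Submodule.ne_bot_iff _).1 hB0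
  have hle : ∀ U ∈ 𝒜, U ≠ ⊥ → A ≤ U := by
    intro U hU hU0
    rcases hA with hA | rfl
    · rcases h𝒜.total hA hU with h | h
      · exact h
      · exact (eq_of_le_of_not_lt h (hAmin U ⟨Or.inl hU, hU0⟩)).ge
    · exact (eq_of_le_of_not_lt le_top (hAmin U ⟨Or.inl hU, hU0⟩)).ge
  have hle' : ∀ U ∈ ℬ, A ⊓ U ≠ ⊥ → B ≤ U := by
    intro U hU hU0
    rcases hB with hB | rfl
    · rcases hℬ.total hB hU with h | h
      · exact h
      · exact (eq_of_le_of_not_lt h (hBmin U ⟨Or.inl hU, hU0⟩)).ge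
    · exact (eq_of_le_of_not_lt le_top (hBmin U ⟨Or.inl hU, hU0⟩)).ge
  -- The members of `ℬ` avoiding `A` form a chain, so their supremum is their union, or `⊥` if there
  -- are none. The functional can thus kill all of them and still be `1` at `v`.
  have hvS : v ∉ sSup {U | U ∈ ℬ ∧ A ⊓ U = ⊥} := by
    intro hv
    by_cases hne : {U | U ∈ ℬ ∧ A ⊓ U = ⊥}.Nonempty
    · rw [Submodule.mem_sSup_of_directed hne] at hv
      · obtain ⟨U, ⟨_, hU⟩, hvU⟩ := hv
        exact hv0 ((Submodule.mem_bot K).1 (hU ▸ ⟨hvA, hvU⟩))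
      · exact (hℬ.mono fun U hU => hU.1).directedOn
    · rw [Set.not_nonempty_iff_eq_empty.1 hne, sSup_empty] at hv
      exact hv0 ((Submodule.mem_bot K).1 hv)
  obtain ⟨φ, hφ, hφv⟩ := LinearMap.exists_extend_of_notMem (K := K) 0 hvS (1 : K)
  refine ⟨v, φ, hφv, ?_⟩
  rintro U (hU | hU)
  · by_cases hU0 : U = ⊥
    · right; rintro x hx
      rw [hU0, Submodule.mem_bot] at hx
      simp [hx]
    · exact Or.inl (hle U hU hU0 hvA)
  · by_cases hU0 : A ⊓ U = ⊥
    · right; intro x hx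
      have := LinearMap.congr_fun hφ ⟨x, le_sSup
        (show U ∈ {U | U ∈ ℬ ∧ A ⊓ U = ⊥} from ⟨hU, hU0⟩) hx⟩
      simpa using this
    · exact Or.inl (hle' U hU hU0 hvB)

/-- In a directed system with a least index, a functional at that index which kills the kernels
of all transition maps extends to a compatible family. -/
theorem exists_compatible_dual {ι : Type*} [Preorder ι] [IsDirectedOrder ι] (i₀ : ι)
    (hi₀ : ∀ i, i₀ ≤ i) {G : ι → Type*} [∀ i, AddCommGroup (G i)] [∀ i, Module K (G i)]
    (f : ∀ i j, i ≤ j → G i →ₗ[K] G j) [DirectedSystem G (f · · ·)] (φ₀ : Module.Dual K (G i₀))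
    (hφ₀ : ∀ i x, f i₀ i (hi₀ i) x = 0 → φ₀ x = 0) :
    ∃ φ : ∀ i, Module.Dual K (G i), φ i₀ = φ₀ ∧ ∀ i j h x, φ j (f i j h x) = φ i x := by
  classical
  -- A vector that dies in the direct limit dies at some stage, so `φ₀` kills it; over a field `φ₀`
  -- then factors through the limit.
  have hmem : φ₀ ∈ (LinearMap.ker (Module.DirectLimit.of K ι G f i₀)).dualAnnihilator := by
    rw [Submodule.mem_dualAnnihilator]
    intro x hx
    obtain ⟨j, hj, hx⟩ := Module.DirectLimit.of.zero_exact (LinearMap.mem_ker.1 hx)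
    exact hφ₀ j x hx
  rw [← LinearMap.range_dualMap_eq_dualAnnihilator_ker] at hmem
  obtain ⟨ψ, rfl⟩ := hmem
  exact ⟨fun i => ψ ∘ₗ Module.DirectLimit.of K ι G f i, rfl, fun i j h x => by simp⟩

end LinearAlgebra

/-! ### Compatible families of vectors and functionals over directed sets. -/

namespace PersistenceModule

variable {K : Type u} [Field K] {P : Type} [PartialOrder P] (F : PersistenceModule K P)

/-- The value of a persistence module at a point. -/
abbrev space (p : P) : ModuleCat.{u} K := F.obj p

/-- The structure map of a persistence module, as a linear map. -/
def transition {p q : P} (h : p ≤ q) : F.obj p →ₗ[K] F.obj q :=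
  (F.map (homOfLE h)).hom

@[simp]
theorem transition_refl {p : P} (h : p ≤ p) (x : F.obj p) : F.transition h x = x := by
  simp [transition]

@[simp]
theorem transition_transition {p q r : P} (h : p ≤ q) (h' : q ≤ r) (x : F.obj p) :
    F.transition h' (F.transition h x) = F.transition (h.trans h') x := by
  have : F.map (homOfLE (h.trans h')) = F.map (homOfLE h) ≫ F.map (homOfLE h') := by
    rw [← F.map_comp]; rfl
  simp [transition, this]

/-- Restriction of a persistence module along a monotone map. -/
def comap {L : Type} [PartialOrder L] (σ : L →o P) : PersistenceModule K L where
  obj s := F.obj (σ s)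
  map f := F.map (homOfLE (σ.monotone (leOfHom f)))
  map_id s := F.map_id _
  map_comp f g := by rw [← F.map_comp]; rfl

/-- A functional at the least element of an up-directed set `I` that kills the kernels of all
structure maps into `I` extends to a compatible family of functionals on `I`. -/
theorem exists_compatible_functionals {I : Set P} (hI : DirectedOn (· ≤ ·) I) {p₀ : P}
    (hp₀ : p₀ ∈ I) (hle : ∀ p ∈ I, p₀ ≤ p) (φ₀ : Module.Dual K (F.obj p₀))
    (hφ₀ : ∀ p (hp : p ∈ I) x, F.transition (hle p hp) x = 0 → φ₀ x = 0) :
    ∃ φ : ∀ p, Module.Dual K (F.obj p), φ p₀ = φ₀ ∧ (∀ p ∉ I, φ p = 0) ∧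
      ∀ p q (h : p ≤ q), p ∈ I → q ∈ I → ∀ x, φ q (F.transition h x) = φ p x := by
  classical
  have : IsDirectedOrder I := ⟨directedOn_iff_directed.1 hI⟩
  have : DirectedSystem (fun i : I => F.obj i.1)
      (fun i j (h : i ≤ j) => F.transition (show i.1 ≤ j.1 from h)) :=
    ⟨fun _ _ => by simp, fun _ _ _ _ _ _ => by simp⟩
  obtain ⟨φ, h₀, hφ⟩ := exists_compatible_dual (K := K) (⟨p₀, hp₀⟩ : I) (fun i => hle i i.2)
    (G := fun i : I => F.obj i.1) (fun i j h => F.transition h) φ₀ (fun i x => hφ₀ i i.2 x)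
  refine ⟨fun p => if hp : p ∈ I then φ ⟨p, hp⟩ else 0, ?_, ?_, ?_⟩
  · simpa [hp₀] using h₀
  · intro p hp
    simp [hp]
  · intro p q h hp hq x
    simpa [hp, hq] using hφ ⟨p, hp⟩ ⟨q, hq⟩ h x

/-- A vector at the greatest element of a down-directed set `I` that lies in the image of every
structure map out of `I` lifts to a compatible family of vectors on `I`. -/
theorem exists_compatible_vectors (hfin : IsPointwiseFiniteDimensional F) {I : Set P}
    (hI : DirectedOn (· ≥ ·) I) {p₀ : P}
    (hp₀ : p₀ ∈ I) (hle : ∀ p ∈ I, p ≤ p₀) (v₀ : F.obj p₀)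
    (hv₀ : ∀ p (hp : p ∈ I), ∃ x, F.transition (hle p hp) x = v₀) :
    ∃ v : ∀ p, F.obj p, v p₀ = v₀ ∧ (∀ p ∉ I, v p = 0) ∧
      ∀ p q (h : p ≤ q), p ∈ I → q ∈ I → F.transition h (v p) = v q := by
  classical
  have (p : P) : FiniteDimensional K (F.obj p) := hfin p
  -- Dualizing turns the inverse system into a direct one, where evaluation at `v₀` extends;
  -- finite-dimensionality turns the resulting double-dual elements back into vectors.
  have : IsDirectedOrder Iᵒᵈ := ⟨(directedOn_iff_directed.1 hI :)⟩
  have : DirectedSystem (fun i : Iᵒᵈ => Module.Dual K (F.obj i.ofDual.1))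
      (fun i j (h : i ≤ j) => (F.transition (show j.ofDual.1 ≤ i.ofDual.1 from h)).dualMap) :=
    ⟨fun _ _ => LinearMap.ext fun _ => by simp, fun _ _ _ _ _ _ => LinearMap.ext fun _ => by simp⟩
  obtain ⟨φ, h₀, hφ⟩ := exists_compatible_dual (K := K) (OrderDual.toDual (⟨p₀, hp₀⟩ : I))
    (fun i => hle i.ofDual i.ofDual.2) (G := fun i : Iᵒᵈ => Module.Dual K (F.obj i.ofDual.1))
    (fun i j h => (F.transition (show j.ofDual.1 ≤ i.ofDual.1 from h)).dualMap)
    (Module.Dual.eval K _ v₀) (by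
      intro i ψ hψ
      obtain ⟨x, hx⟩ := hv₀ i.ofDual i.ofDual.2
      exact (congrArg ψ hx).symm.trans (LinearMap.congr_fun hψ x))
  have key : ∀ p : I, ∃ x : F.obj p.1, Module.Dual.eval K _ x = φ (OrderDual.toDual p) :=
    fun p => (Module.evalEquiv K (F.obj p.1)).surjective _
  choose v hv using key
  have hinj : ∀ p, Function.Injective (Module.Dual.eval K (F.obj p)) :=
    fun p => (Module.evalEquiv K (F.obj p)).injective
  refine ⟨fun p => if hp : p ∈ I then v ⟨p, hp⟩ else 0, ?_, ?_, ?_⟩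
  · simp only [hp₀, dif_pos]
    exact hinj _ ((hv _).trans h₀)
  · intro p hp
    simp [hp]
  · intro p q h hp hq
    simp only [hp, hq, dif_pos]
    refine hinj _ (LinearMap.ext fun ψ => ?_)
    have h₁ := LinearMap.congr_fun (hv ⟨p, hp⟩) ((F.transition h).dualMap ψ)
    have h₂ := LinearMap.congr_fun (hv ⟨q, hq⟩) ψ
    have h₃ := hφ (OrderDual.toDual ⟨q, hq⟩) (OrderDual.toDual ⟨p, hp⟩) h ψ
    exact h₁.trans (h₃.trans h₂.symm)

end PersistenceModule

/-! ### Interval summands and how they lift. -/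

namespace PersistenceModule

/-- A compatible pair of a family of vectors and a family of functionals, supported on a set and
normalized there: the data of a retract of `F` isomorphic to the interval module of the support. -/
structure IntervalSummand {K : Type u} [Field K] {P : Type} [PartialOrder P]
    (F : PersistenceModule K P) where
  support : Set P
  gen : ∀ p, F.obj p
  coord : ∀ p, Module.Dual K (F.obj p)
  gen_eq_zero : ∀ p ∉ support, gen p = 0
  coord_eq_zero : ∀ p ∉ support, coord p = 0
  coord_gen : ∀ p ∈ support, coord p (gen p) = 1
  map_gen : ∀ p q (h : p ≤ q), p ∈ support → F.transition h (gen p) = gen q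
  coord_map : ∀ p q (h : p ≤ q), q ∈ support → ∀ x, coord q (F.transition h x) = coord p x

section Lift

variable {K : Type u} [Field K] {P : Type} [PartialOrder P] (F : PersistenceModule K P)

/-- An interval summand of the restriction of `F` along `σ` lifts to `F` if the maps from `F p` to
`F (σ (π p))` restrict to isomorphisms on a submodule `R` of `F`. -/
theorem IntervalSummand.exists_lift {L : Type} [PartialOrder L] (π : P →o L) (σ : L →o P)
    (hle : ∀ p, p ≤ σ (π p)) (R : ∀ p, Submodule K (F.obj p))
    (hR : ∀ p q (h : p ≤ q), ∀ x ∈ R p, F.transition h x ∈ R q)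
    (hsurj : ∀ p (y : F.obj (σ (π p))), ∃ x ∈ R p, F.transition (hle p) x = y)
    (hinj : ∀ p, ∀ x ∈ R p, F.transition (hle p) x = 0 → x = 0)
    (G : IntervalSummand (F.comap σ)) :
    ∃ G' : IntervalSummand F, G'.support = π ⁻¹' G.support := by
  obtain ⟨J, g, c, hJ, hg₀, hc₀, hcg, hg, hc⟩ : ∃ (J : Set L) (g : ∀ s, F.obj (σ s))
      (c : ∀ s, Module.Dual K (F.obj (σ s))), J = G.support ∧ (∀ s ∉ J, g s = 0) ∧
        (∀ s ∉ J, c s = 0) ∧ (∀ s ∈ J, c s (g s) = 1) ∧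
        (∀ s t (h : s ≤ t), s ∈ J → F.transition (σ.monotone h) (g s) = g t) ∧
        ∀ s t (h : s ≤ t), t ∈ J → ∀ x, c t (F.transition (σ.monotone h) x) = c s x :=
    ⟨G.support, G.gen, G.coord, rfl, G.gen_eq_zero, G.coord_eq_zero, G.coord_gen, G.map_gen,
      G.coord_map⟩
  choose v hvR hv using fun p => hsurj p (g (π p))
  refine ⟨⟨π ⁻¹' J, v, fun p => c (π p) ∘ₗ F.transition (hle p), ?_, ?_, ?_, ?_, ?_⟩,
    congrArg (π ⁻¹' ·) hJ⟩
  · intro p hp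
    exact hinj p _ (hvR p) ((hv p).trans (hg₀ _ hp))
  · intro p hp
    rw [hc₀ _ hp, LinearMap.zero_comp]
  · intro p hp
    rw [LinearMap.comp_apply, hv, hcg _ hp]
  · intro p q h hp
    -- Both vectors lie in `R q`, so it is enough to compare their images in `F (σ (π q))`.
    refine sub_eq_zero.1 (hinj q _ (sub_mem (hR p q h _ (hvR p)) (hvR q)) ?_)
    rw [map_sub, hv, sub_eq_zero, transition_transition,
      ← F.transition_transition (hle p) (σ.monotone (π.monotone h)), hv,
      hg _ _ (π.monotone h) hp]
  · intro p q h hq x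
    rw [LinearMap.comp_apply, LinearMap.comp_apply, transition_transition,
      ← F.transition_transition (hle p) (σ.monotone (π.monotone h)),
      hc _ _ (π.monotone h) hq]

end Lift

/-! ### Interval summands over a linear order. -/

section Linear

variable {K : Type u} [Field K] {L : Type} [LinearOrder L] (M : PersistenceModule K L)

theorem isInterval_of_ordConnected {J : Set L} (hJ : J.OrdConnected) : IsInterval J where
  convex _ _ _ hx hy hxz hzy := hJ.out hx hy ⟨hxz, hzy⟩
  connected x y := Relation.ReflTransGen.single (le_total x y)

/-- A pointwise finite-dimensional persistence module over a linear order has an interval summand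
through every point where it does not vanish. -/
theorem exists_intervalSummand_linear (hfin : IsPointwiseFiniteDimensional M) (s₀ : L)
    [Nontrivial (M.obj s₀)] :
    ∃ G : IntervalSummand M, s₀ ∈ G.support ∧ IsInterval G.support := by
  classical
  have := hfin s₀
  obtain ⟨v, φ, hφv, hadapted⟩ := exists_vector_functional_of_isChain (K := K) (V := M.obj s₀)
    (𝒜 := {U | ∃ s, ∃ h : s ≤ s₀, U = LinearMap.range (M.transition h)})
    (ℬ := {U | ∃ s, ∃ h : s₀ ≤ s, U = LinearMap.ker (M.transition h)})
    (by
      have key : ∀ s t (h : s ≤ s₀) (h' : t ≤ s₀), s ≤ t →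
          LinearMap.range (M.transition h) ≤ LinearMap.range (M.transition h') := by
        rintro s t h h' hst _ ⟨x, rfl⟩
        exact ⟨M.transition hst x, by simp⟩
      rintro _ ⟨s, h, rfl⟩ _ ⟨t, h', rfl⟩ -
      exact (le_total s t).imp (key s t h h') (key t s h' h))
    (by
      have key : ∀ s t (h : s₀ ≤ s) (h' : s₀ ≤ t), s ≤ t →
          LinearMap.ker (M.transition h) ≤ LinearMap.ker (M.transition h') := by
        intro s t h h' hst x hx
        rw [LinearMap.mem_ker] at hx ⊢
        rw [← M.transition_transition h hst, hx, map_zero]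
      rintro _ ⟨s, h, rfl⟩ _ ⟨t, h', rfl⟩ -
      exact (le_total s t).imp (key s t h h') (key t s h' h))
  have hrange : ∀ s (h : s ≤ s₀), (∃ x, M.transition h x = v) ∨ ∀ x, φ (M.transition h x) = 0 := by
    intro s h
    exact (hadapted _ (Or.inl ⟨s, h, rfl⟩)).imp id fun H x => H _ ⟨x, rfl⟩
  have hker : ∀ s (h : s₀ ≤ s), M.transition h v = 0 ∨ ∀ x, M.transition h x = 0 → φ x = 0 := by
    intro s h
    exact (hadapted _ (Or.inr ⟨s, h, rfl⟩)).imp LinearMap.mem_ker.1 fun H x hx => H _ hx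
  have hv0 : v ≠ 0 := by
    rintro rfl
    simp at hφv
  -- The support has two halves: below `s₀`, the points from which `v` comes; above `s₀`, those that
  -- `v` reaches without dying.
  let I₁ : Set L := {s | ∃ h : s ≤ s₀, ∃ x, M.transition h x = v}
  let I₂ : Set L := {s | ∃ h : s₀ ≤ s, M.transition h v ≠ 0}
  have hs₁ : s₀ ∈ I₁ := ⟨le_rfl, v, by simp⟩
  have hs₂ : s₀ ∈ I₂ := ⟨le_rfl, by simpa using hv0⟩
  have hI₁ : ∀ s t, s ≤ t → t ≤ s₀ → s ∈ I₁ → t ∈ I₁ := by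
    rintro s t hst ht ⟨h, x, hx⟩
    exact ⟨ht, M.transition hst x, by simpa using hx⟩
  have hI₂ : ∀ s t, s ≤ t → s₀ ≤ s → t ∈ I₂ → s ∈ I₂ := by
    rintro s t hst hs ⟨h, hx⟩
    refine ⟨hs, fun h0 => hx ?_⟩
    rw [← M.transition_transition hs hst, h0, map_zero]
  have hJ₁ : ∀ s ≤ s₀, s ∈ I₁ ∪ I₂ → s ∈ I₁ := by
    rintro s hs (h | ⟨h, -⟩)
    · exact h
    · rwa [le_antisymm hs h]
  have hJ₂ : ∀ s, s₀ ≤ s → s ∈ I₁ ∪ I₂ → s ∈ I₂ := by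
    rintro s hs (⟨h, -⟩ | h)
    · rwa [le_antisymm h hs]
    · exact h
  obtain ⟨w, hw₀, hw, hwc⟩ := M.exists_compatible_vectors hfin (I := I₁)
    (fun s hs t ht => (le_total s t).elim (fun h => ⟨s, hs, le_rfl, h⟩) fun h => ⟨t, ht, h, le_rfl⟩)
    hs₁ (fun s hs => hs.1) v (fun s hs => hs.2)
  obtain ⟨ψ, hψ₀, hψ, hψc⟩ := M.exists_compatible_functionals (I := I₂)
    (fun s hs t ht => (le_total s t).elim (fun h => ⟨t, ht, h, le_rfl⟩) fun h => ⟨s, hs, le_rfl, h⟩)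
    hs₂ (fun s hs => hs.1) φ (fun s hs => (hker s hs.1).resolve_left hs.2)
  -- Vectors are pushed forward above `s₀` and chosen as lifts below it; functionals are pulled back
  -- below `s₀` and chosen as extensions above it.
  refine ⟨⟨I₁ ∪ I₂, fun s => if h : s₀ ≤ s then M.transition h v else w s,
    fun s => if h : s ≤ s₀ then φ ∘ₗ M.transition h else ψ s, ?_, ?_, ?_, ?_, ?_⟩, Or.inl hs₁, ?_⟩
  · intro s hs
    by_cases h : s₀ ≤ s
    · rw [dif_pos h]
      by_contra h0
      exact hs (Or.inr ⟨h, h0⟩)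
    · rw [dif_neg h]
      exact hw s fun h => hs (Or.inl h)
  · intro s hs
    by_cases h : s ≤ s₀
    · rw [dif_pos h]
      exact LinearMap.ext ((hrange s h).resolve_left fun h0 => hs (Or.inl ⟨h, h0⟩))
    · rw [dif_neg h]
      exact hψ s fun h => hs (Or.inr h)
  · intro s hs
    by_cases h : s₀ ≤ s
    · by_cases h' : s ≤ s₀
      · obtain rfl := le_antisymm h h'
        simpa using hφv
      · rw [dif_pos h, dif_neg h', hψc _ _ h hs₂ (hJ₂ s h hs), hψ₀, hφv]
    · have h' := (not_le.1 h).le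
      rw [dif_neg h, dif_pos h', LinearMap.comp_apply, hwc _ _ h' (hJ₁ s h' hs) hs₁, hw₀, hφv]
  · intro s t hst hs
    by_cases h : s₀ ≤ s
    · rw [dif_pos h, dif_pos (h.trans hst), transition_transition]
    · have h₁ := (not_le.1 h).le
      rw [dif_neg h]
      by_cases h' : s₀ ≤ t
      · rw [dif_pos h', ← M.transition_transition h₁ h', hwc _ _ h₁ (hJ₁ s h₁ hs) hs₁, hw₀]
      · have h₂ := (not_le.1 h').le
        rw [dif_neg h']
        exact hwc _ _ hst (hJ₁ s h₁ hs) (hI₁ s t hst h₂ (hJ₁ s h₁ hs))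
  · intro s t hst ht x
    by_cases h : t ≤ s₀
    · rw [dif_pos h, dif_pos (hst.trans h), LinearMap.comp_apply, LinearMap.comp_apply,
        transition_transition]
    · have h₂ := (not_le.1 h).le
      rw [dif_neg h]
      by_cases h' : s ≤ s₀
      · rw [dif_pos h', ← M.transition_transition h' h₂, hψc _ _ h₂ hs₂ (hJ₂ t h₂ ht), hψ₀,
          LinearMap.comp_apply]
      · have h₁ := (not_le.1 h').le
        rw [dif_neg h']
        exact hψc _ _ hst (hI₂ s t hst h₁ (hJ₂ t h₂ ht)) (hJ₂ t h₂ ht) x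
  · refine isInterval_of_ordConnected ⟨fun s hs t ht r hr => ?_⟩
    rcases le_total r s₀ with h | h
    · exact Or.inl (hI₁ s r hr.1 h (hJ₁ s (hr.1.trans h) hs))
    · exact Or.inr (hI₂ r t hr.2 h (hJ₂ t (h.trans hr.2) ht))

end Linear

/-! ### Death and birth blocks over a product of two linear orders. -/

section Product

variable {K : Type u} [Field K] {S T : Type} [LinearOrder S] [LinearOrder T]
  (F : PersistenceModule K (S × T))

/-- Middle-exactness in terms of elements. -/
def HasMiddleLifts : Prop :=
  ∀ (s s' : S) (t t' : T) (hs : s ≤ s') (ht : t ≤ t') (a : F.space (s, t')) (b : F.space (s', t)),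
    F.transition (show (s, t') ≤ (s', t') from ⟨hs, le_rfl⟩) a =
      F.transition (show (s', t) ≤ (s', t') from ⟨le_rfl, ht⟩) b →
    ∃ c : F.space (s, t), F.transition (show (s, t) ≤ (s, t') from ⟨le_rfl, ht⟩) c = a ∧
      F.transition (show (s, t) ≤ (s', t) from ⟨hs, le_rfl⟩) c = b

theorem _root_.MiddleExactSquare.exists_lift {A B C D : ModuleCat.{u} K}
    {α : A ⟶ B} {f : A ⟶ C} {g : B ⟶ D} {β : C ⟶ D} {sq : CommSq α f g β}
    (h : MiddleExactSquare sq) (b : B) (c : C) (hbc : g.hom b = β.hom c) :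
    ∃ a : A, α.hom a = b ∧ f.hom a = c := by
  obtain ⟨a, ha⟩ := (ShortComplex.moduleCat_exact_iff _).1 h
    ((biprod.inl : B ⟶ B ⊞ C).hom b + (biprod.inr : C ⟶ B ⊞ C).hom c) (by
      have h₁ := congrArg (fun k => k.hom b) (biprod.inl_desc g (-β))
      have h₂ := congrArg (fun k => k.hom c) (biprod.inr_desc g (-β))
      simp only [ModuleCat.hom_comp, LinearMap.comp_apply, ModuleCat.hom_neg,
        LinearMap.neg_apply] at h₁ h₂
      change (biprod.desc g (-β)).hom _ = 0
      rw [map_add, h₁, h₂, hbc, add_neg_cancel])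
  refine ⟨a, ?_, ?_⟩
  · have h₁ := congrArg (fun k => k.hom a) (biprod.lift_fst α f)
    have h₂ := congrArg (fun k => k.hom b) (biprod.inl_fst (X := B) (Y := C))
    have h₃ := congrArg (fun k => k.hom c) (biprod.inr_fst (X := B) (Y := C))
    simp only [ModuleCat.hom_comp, LinearMap.comp_apply] at h₁ h₂ h₃
    change (biprod.lift α f).hom a = _ at ha
    rw [ha, map_add, h₂, h₃] at h₁
    simpa using h₁.symm
  · have h₁ := congrArg (fun k => k.hom a) (biprod.lift_snd α f)
    have h₂ := congrArg (fun k => k.hom b) (biprod.inl_snd (X := B) (Y := C))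
    have h₃ := congrArg (fun k => k.hom c) (biprod.inr_snd (X := B) (Y := C))
    simp only [ModuleCat.hom_comp, LinearMap.comp_apply] at h₁ h₂ h₃
    change (biprod.lift α f).hom a = _ at ha
    rw [ha, map_add, h₂, h₃] at h₁
    simpa using h₁.symm

variable {F}

theorem _root_.IsMiddleExact.hasMiddleLifts (hF : IsMiddleExact F) : F.HasMiddleLifts := by
  have key : ∀ (x y z w : S × T) (hz : x ⊓ y = z) (hw : x ⊔ y = w) (a : F.space x) (b : F.space y),
      F.transition (hw ▸ le_sup_left : x ≤ w) a = F.transition (hw ▸ le_sup_right : y ≤ w) b →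
      ∃ c : F.space z, F.transition (hz ▸ inf_le_left : z ≤ x) c = a ∧
        F.transition (hz ▸ inf_le_right : z ≤ y) c = b := by
    rintro x y z w rfl rfl a b hab
    exact (hF x y).exists_lift a b hab
  intro s s' t t' hs ht a b hab
  exact key (s, t') (s', t) (s, t) (s', t') (by simp [hs, ht]) (by simp [hs, ht]) a b hab

/-- In a linear order the supremum of two elements is one of them, so every subset is closed under
it. -/
theorem directedOn_le_prod (J₁ : Set S) (J₂ : Set T) : DirectedOn (· ≤ ·) (J₁ ×ˢ J₂) := by
  rintro ⟨a, b⟩ ⟨ha, hb⟩ ⟨c, d⟩ ⟨hc, hd⟩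
  exact ⟨(a ⊔ c, b ⊔ d), ⟨sup_ind (p := (· ∈ J₁)) a c ha hc, sup_ind (p := (· ∈ J₂)) b d hb hd⟩,
    ⟨le_sup_left, le_sup_left⟩, ⟨le_sup_right, le_sup_right⟩⟩

theorem directedOn_ge_prod (J₁ : Set S) (J₂ : Set T) : DirectedOn (· ≥ ·) (J₁ ×ˢ J₂) := by
  rintro ⟨a, b⟩ ⟨ha, hb⟩ ⟨c, d⟩ ⟨hc, hd⟩
  exact ⟨(a ⊓ c, b ⊓ d), ⟨inf_ind (p := (· ∈ J₁)) a c ha hc, inf_ind (p := (· ∈ J₂)) b d hb hd⟩,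
    ⟨inf_le_left, inf_le_left⟩, ⟨inf_le_right, inf_le_right⟩⟩

/-- A middle-exact module that does not vanish at the bottom has a death block summand. -/
theorem exists_intervalSummand_death [OrderBot S] [OrderBot T]
    (hfin : IsPointwiseFiniteDimensional F) (hF : F.HasMiddleLifts)
    [Nontrivial (F.space (⊥, ⊥))] :
    ∃ (G : IntervalSummand F) (J₁ : Set S) (J₂ : Set T), IsLowerSet J₁ ∧ IsLowerSet J₂ ∧
      G.support = J₁ ×ˢ J₂ ∧ (⊥, ⊥) ∈ G.support := by
  have := hfin (⊥, ⊥)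
  let A (s : S) := LinearMap.ker
    (F.transition (show ((⊥, ⊥) : S × T) ≤ (s, ⊥) from ⟨bot_le, le_rfl⟩))
  let B (t : T) := LinearMap.ker
    (F.transition (show ((⊥, ⊥) : S × T) ≤ (⊥, t) from ⟨le_rfl, bot_le⟩))
  have hA : Monotone A := by
    intro s s' h x hx
    rw [LinearMap.mem_ker] at hx ⊢
    rw [← F.transition_transition (show ((⊥, ⊥) : S × T) ≤ (s, ⊥) from ⟨bot_le, le_rfl⟩)
      (show ((s, ⊥) : S × T) ≤ (s', ⊥) from ⟨h, le_rfl⟩), hx, map_zero]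
  have hB : Monotone B := by
    intro t t' h x hx
    rw [LinearMap.mem_ker] at hx ⊢
    rw [← F.transition_transition (show ((⊥, ⊥) : S × T) ≤ (⊥, t) from ⟨le_rfl, bot_le⟩)
      (show ((⊥, t) : S × T) ≤ (⊥, t') from ⟨le_rfl, h⟩), hx, map_zero]
  have hbot (p : S × T) : (⊥, ⊥) ≤ p := ⟨bot_le, bot_le⟩
  obtain ⟨v, φ, hφv, hadapted⟩ := exists_vector_functional_of_isChain (K := K)
    (𝒜 := Set.range A) (ℬ := Set.range B) hA.isChain_range hB.isChain_range
  -- The pair formed by `0` at `(⊥, t)` and the image of `x` at `(s, ⊥)` agrees at `(s, t)`. A lift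
  -- `z` of it lies in `B t`, and `x - z` lies in `A s`.
  have hsplit : ∀ s t x, F.transition (hbot (s, t)) x = 0 → ∃ y ∈ A s, ∃ z ∈ B t, x = y + z := by
    intro s t x hx
    obtain ⟨z, hz₁, hz₂⟩ := hF ⊥ s ⊥ t bot_le bot_le 0
      (F.transition (show ((⊥, ⊥) : S × T) ≤ (s, ⊥) from ⟨bot_le, le_rfl⟩) x)
      (by simpa using hx.symm)
    exact ⟨x - z, by simp [A, hz₂], z, hz₁, by simp⟩
  have hAz : ∀ s t, ∀ x ∈ A s, F.transition (hbot (s, t)) x = 0 := by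
    intro s t x hx
    rw [← F.transition_transition (show ((⊥, ⊥) : S × T) ≤ (s, ⊥) from ⟨bot_le, le_rfl⟩)
      (show ((s, ⊥) : S × T) ≤ (s, t) from ⟨le_rfl, bot_le⟩),
      LinearMap.mem_ker.1 hx, map_zero]
  have hBz : ∀ s t, ∀ x ∈ B t, F.transition (hbot (s, t)) x = 0 := by
    intro s t x hx
    rw [← F.transition_transition (show ((⊥, ⊥) : S × T) ≤ (⊥, t) from ⟨le_rfl, bot_le⟩)
      (show ((⊥, t) : S × T) ≤ (s, t) from ⟨bot_le, le_rfl⟩),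
      LinearMap.mem_ker.1 hx, map_zero]
  have hv0 : v ≠ 0 := by
    rintro rfl
    simp at hφv
  let J₁ : Set S := {s | v ∉ A s}
  let J₂ : Set T := {t | v ∉ B t}
  have hJ₁ : IsLowerSet J₁ := fun s s' h hs hs' => hs (hA h hs')
  have hJ₂ : IsLowerSet J₂ := fun s s' h hs hs' => hs (hB h hs')
  have hmem : ((⊥, ⊥) : S × T) ∈ J₁ ×ˢ J₂ :=
    ⟨by simpa [J₁, A] using hv0, by simpa [J₂, B] using hv0⟩
  obtain ⟨ψ, hψ₀, hψ, hψc⟩ := F.exists_compatible_functionals (directedOn_le_prod J₁ J₂) hmem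
    (fun p _ => hbot p) φ (by
      rintro ⟨s, t⟩ ⟨hs, ht⟩ x hx
      obtain ⟨y, hy, z, hz, rfl⟩ := hsplit s t x hx
      rw [map_add, (hadapted (A s) (Or.inl ⟨s, rfl⟩)).resolve_left hs y hy,
        (hadapted (B t) (Or.inr ⟨t, rfl⟩)).resolve_left ht z hz, add_zero])
  refine ⟨⟨J₁ ×ˢ J₂, fun p => F.transition (hbot p) v, ψ, ?_, hψ, ?_, ?_, ?_⟩,
    J₁, J₂, hJ₁, hJ₂, rfl, hmem⟩
  · rintro ⟨s, t⟩ h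
    by_cases hs : v ∈ A s
    · exact hAz s t v hs
    · exact hBz s t v (by_contra fun ht => h ⟨hs, ht⟩)
  · intro p hp
    rw [hψc _ _ _ hmem hp, hψ₀, hφv]
  · intro p q h _
    simp
  · intro p q h hq x
    exact hψc p q h ((hJ₁.prod hJ₂) h hq) hq x

/-- A middle-exact module that does not vanish at the top has a birth block summand. -/
theorem exists_intervalSummand_birth [OrderTop S] [OrderTop T]
    (hfin : IsPointwiseFiniteDimensional F) (hF : F.HasMiddleLifts)
    [Nontrivial (F.space (⊤, ⊤))] :
    ∃ (G : IntervalSummand F) (J₁ : Set S) (J₂ : Set T), IsUpperSet J₁ ∧ IsUpperSet J₂ ∧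
      G.support = J₁ ×ˢ J₂ ∧ (⊤, ⊤) ∈ G.support := by
  have := hfin (⊤, ⊤)
  let A (s : S) := LinearMap.range
    (F.transition (show ((s, ⊤) : S × T) ≤ (⊤, ⊤) from ⟨le_top, le_rfl⟩))
  let B (t : T) := LinearMap.range
    (F.transition (show ((⊤, t) : S × T) ≤ (⊤, ⊤) from ⟨le_rfl, le_top⟩))
  have hA : Monotone A := by
    rintro s s' h _ ⟨x, rfl⟩
    exact ⟨F.transition (show ((s, ⊤) : S × T) ≤ (s', ⊤) from ⟨h, le_rfl⟩) x, by simp⟩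
  have hB : Monotone B := by
    rintro t t' h _ ⟨x, rfl⟩
    exact ⟨F.transition (show ((⊤, t) : S × T) ≤ (⊤, t') from ⟨le_rfl, h⟩) x, by simp⟩
  have htop (p : S × T) : p ≤ (⊤, ⊤) := ⟨le_top, le_top⟩
  obtain ⟨v, φ, hφv, hadapted⟩ := exists_vector_functional_of_isChain (K := K)
    (𝒜 := Set.range A) (ℬ := Set.range B) hA.isChain_range hB.isChain_range
  -- Dually to the death case, preimages of `v` on the two edges agree at the top corner and so lift
  -- to `(s, t)`.
  have hlift : ∀ s t, v ∈ A s → v ∈ B t → ∃ x, F.transition (htop (s, t)) x = v := by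
    rintro s t ⟨a, ha⟩ ⟨b, hb⟩
    obtain ⟨x, hx, -⟩ := hF s ⊤ t ⊤ le_top le_top a b (ha.trans hb.symm)
    refine ⟨x, ?_⟩
    rw [← F.transition_transition (show ((s, t) : S × T) ≤ (s, ⊤) from ⟨le_rfl, le_top⟩)
      (show ((s, ⊤) : S × T) ≤ (⊤, ⊤) from ⟨le_top, le_rfl⟩), hx, ha]
  have hAz : ∀ s t x, F.transition (htop (s, t)) x ∈ A s := fun s t x =>
    ⟨F.transition (show ((s, t) : S × T) ≤ (s, ⊤) from ⟨le_rfl, le_top⟩) x, by simp⟩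
  have hBz : ∀ s t x, F.transition (htop (s, t)) x ∈ B t := fun s t x =>
    ⟨F.transition (show ((s, t) : S × T) ≤ (⊤, t) from ⟨le_top, le_rfl⟩) x, by simp⟩
  let J₁ : Set S := {s | v ∈ A s}
  let J₂ : Set T := {t | v ∈ B t}
  have hJ₁ : IsUpperSet J₁ := fun s s' h hs => hA h hs
  have hJ₂ : IsUpperSet J₂ := fun s s' h hs => hB h hs
  have hmem : ((⊤, ⊤) : S × T) ∈ J₁ ×ˢ J₂ := ⟨⟨v, by simp⟩, ⟨v, by simp⟩⟩
  obtain ⟨w, hw₀, hw, hwc⟩ := F.exists_compatible_vectors hfin (directedOn_ge_prod J₁ J₂) hmem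
    (fun p _ => htop p) v (fun p hp => hlift p.1 p.2 hp.1 hp.2)
  refine ⟨⟨J₁ ×ˢ J₂, w, fun p => φ ∘ₗ F.transition (htop p), hw, ?_, ?_, ?_, ?_⟩,
    J₁, J₂, hJ₁, hJ₂, rfl, hmem⟩
  · rintro ⟨s, t⟩ h
    refine LinearMap.ext fun x => ?_
    by_cases hs : v ∈ A s
    · exact (hadapted (B t) (Or.inr ⟨t, rfl⟩)).resolve_left (fun ht => h ⟨hs, ht⟩) _ (hBz s t x)
    · exact (hadapted (A s) (Or.inl ⟨s, rfl⟩)).resolve_left hs _ (hAz s t x)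
  · intro p hp
    rw [LinearMap.comp_apply, hwc _ _ _ hp hmem, hw₀, hφv]
  · intro p q h hp
    exact hwc p q h hp ((hJ₁.prod hJ₂) h hp)
  · intro p q h hq x
    simp

/-! ### Vertical and horizontal blocks when both extreme corners vanish. -/

section Bounded

variable [BoundedOrder S] [BoundedOrder T]

/-- Since `x` dies at `(s, ⊤)`, it comes from some `c` at `(⊥, t)`; since `c` dies at `(⊤, t)`, it
comes from the zero space at `(⊥, ⊥)`. -/
theorem HasMiddleLifts.eq_zero (hF : F.HasMiddleLifts) [Subsingleton (F.space (⊥, ⊥))]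
    {s : S} {t : T}
    {x : F.space (s, t)} (h₁ : F.transition (show (s, t) ≤ (⊤, t) from ⟨le_top, le_rfl⟩) x = 0)
    (h₂ : F.transition (show (s, t) ≤ (s, ⊤) from ⟨le_rfl, le_top⟩) x = 0) : x = 0 := by
  obtain ⟨c, -, rfl⟩ := hF ⊥ s t ⊤ bot_le le_top 0 x (by rw [h₂, map_zero])
  rw [transition_transition] at h₁
  obtain ⟨d, rfl, -⟩ := hF ⊥ ⊤ ⊥ t bot_le bot_le c 0 (by rw [map_zero]; exact h₁)
  rw [Subsingleton.elim d 0, map_zero, map_zero]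

/-- The kernels of the maps to `(⊤, t)` form a submodule isomorphic to the pullback of the top edge.
Surjectivity uses that `F (⊤, ⊤) = 0` makes `(y, 0)` a compatible pair; injectivity is
`HasMiddleLifts.eq_zero`. -/
theorem HasMiddleLifts.exists_vertical (hF : F.HasMiddleLifts)
    (hfin : IsPointwiseFiniteDimensional F) [Subsingleton (F.space (⊥, ⊥))]
    [Subsingleton (F.space (⊤, ⊤))] (s₀ : S) [Nontrivial (F.space (s₀, ⊤))] :
    ∃ (G : IntervalSummand F) (J : Set S), IsInterval J ∧ s₀ ∈ J ∧
      G.support = J ×ˢ (Set.univ : Set T) := by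
  let σ : S →o S × T := ⟨fun s => (s, ⊤), fun s s' h => ⟨h, le_rfl⟩⟩
  have : Nontrivial ((F.comap σ).obj s₀) := ‹Nontrivial (F.space (s₀, ⊤))›
  obtain ⟨G, hG, hG'⟩ := exists_intervalSummand_linear (F.comap σ) (fun s => hfin _) s₀
  obtain ⟨G', hG''⟩ := IntervalSummand.exists_lift F OrderHom.fst σ (fun p => ⟨le_rfl, le_top⟩)
    (fun p => LinearMap.ker (F.transition (show p ≤ (⊤, p.2) from ⟨le_top, le_rfl⟩)))
    (by
      intro p q h x hx
      rw [LinearMap.mem_ker] at hx ⊢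
      rw [transition_transition, ← F.transition_transition
        (show p ≤ (⊤, p.2) from ⟨le_top, le_rfl⟩)
        (show ((⊤, p.2) : S × T) ≤ (⊤, q.2) from ⟨le_rfl, h.2⟩), hx, map_zero])
    (by
      rintro ⟨s, t⟩ y
      obtain ⟨c, hc, hc'⟩ := hF s ⊤ t ⊤ le_top le_top y 0 (Subsingleton.elim _ _)
      exact ⟨c, hc', hc⟩)
    (fun p x hx hx' => hF.eq_zero hx hx') G
  exact ⟨G', G.support, hG', hG, hG''.trans (Set.prod_univ).symm⟩

theorem HasMiddleLifts.exists_horizontal (hF : F.HasMiddleLifts)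
    (hfin : IsPointwiseFiniteDimensional F) [Subsingleton (F.space (⊥, ⊥))]
    [Subsingleton (F.space (⊤, ⊤))] (t₀ : T) [Nontrivial (F.space (⊤, t₀))] :
    ∃ (G : IntervalSummand F) (J : Set T), IsInterval J ∧ t₀ ∈ J ∧
      G.support = (Set.univ : Set S) ×ˢ J := by
  let σ : T →o S × T := ⟨fun t => (⊤, t), fun s s' h => ⟨le_rfl, h⟩⟩
  have : Nontrivial ((F.comap σ).obj t₀) := ‹Nontrivial (F.space (⊤, t₀))›
  obtain ⟨G, hG, hG'⟩ := exists_intervalSummand_linear (F.comap σ) (fun s => hfin _) t₀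
  obtain ⟨G', hG''⟩ := IntervalSummand.exists_lift F OrderHom.snd σ (fun p => ⟨le_top, le_rfl⟩)
    (fun p => LinearMap.ker (F.transition (show p ≤ (p.1, ⊤) from ⟨le_rfl, le_top⟩)))
    (by
      intro p q h x hx
      rw [LinearMap.mem_ker] at hx ⊢
      rw [transition_transition, ← F.transition_transition
        (show p ≤ (p.1, ⊤) from ⟨le_rfl, le_top⟩)
        (show ((p.1, ⊤) : S × T) ≤ (q.1, ⊤) from ⟨h.1, le_rfl⟩), hx, map_zero])
    (by
      rintro ⟨s, t⟩ y
      obtain ⟨c, hc, hc'⟩ := hF s ⊤ t ⊤ le_top le_top 0 y (Subsingleton.elim _ _)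
      exact ⟨c, hc, hc'⟩)
    (fun p x hx hx' => hF.eq_zero hx' hx) G
  exact ⟨G', G.support, hG', hG, hG''.trans (Set.univ_prod).symm⟩

end Bounded

end Product

/-! ### Blocks in the extended quadrant. -/

section Block

variable {K : Type u} [Field K] {F : PersistenceModule K (ℝ≥0∞ × ℝ≥0∞)}

theorem _root_.isBlock_death {J₁ J₂ : Set ℝ≥0∞} (h₁ : IsLowerSet J₁) (h₂ : IsLowerSet J₂) :
    IsBlock (J₁ ×ˢ J₂) where
  isInterval :=
    { convex := fun _ _ _ _ hy _ hzy => (h₁.prod h₂) hzy hy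
      connected := fun x y => by
        have hbot : (⊥ : ℝ≥0∞ × ℝ≥0∞) ∈ J₁ ×ˢ J₂ := (h₁.prod h₂) bot_le x.2
        exact (Relation.ReflTransGen.single
          (b := (⟨⊥, hbot⟩ : ↥(J₁ ×ˢ J₂))) (Or.inr (Subtype.mk_le_mk.2 bot_le))).tail
          (Or.inl (Subtype.mk_le_mk.2 bot_le)) }
  cases := Or.inl ⟨J₁, J₂, h₁, h₂, rfl⟩

theorem _root_.isBlock_birth {J₁ J₂ : Set ℝ≥0∞} (h₁ : IsUpperSet J₁) (h₂ : IsUpperSet J₂) :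
    IsBlock (J₁ ×ˢ J₂) where
  isInterval :=
    { convex := fun _ _ _ hx _ hxz _ => (h₁.prod h₂) hxz hx
      connected := fun x y => by
        have htop : (⊤ : ℝ≥0∞ × ℝ≥0∞) ∈ J₁ ×ˢ J₂ := (h₁.prod h₂) le_top x.2
        exact (Relation.ReflTransGen.single
          (b := (⟨⊤, htop⟩ : ↥(J₁ ×ˢ J₂))) (Or.inl (Subtype.mk_le_mk.2 le_top))).tail
          (Or.inr (Subtype.mk_le_mk.2 le_top)) }
  cases := Or.inr (Or.inl ⟨J₁, J₂, h₁, h₂, rfl⟩)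

theorem _root_.isBlock_vertical {J : Set ℝ≥0∞} (hJ : IsInterval J) :
    IsBlock (J ×ˢ (Set.univ : Set ℝ≥0∞)) where
  isInterval :=
    { convex := fun _ _ _ hx hy hxz hzy => ⟨hJ.convex hx.1 hy.1 hxz.1 hzy.1, trivial⟩
      connected := by
        rintro ⟨⟨s, t⟩, hs, ht⟩ ⟨⟨s', t'⟩, hs', ht'⟩
        refine ((Relation.ReflTransGen.single (b := (⟨(s, ⊤), hs, trivial⟩ : ↥(J ×ˢ Set.univ)))
          (Or.inl ⟨le_rfl, le_top⟩)).tail (b := ⟨(s, ⊤), hs, trivial⟩)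
          (c := ⟨(s', ⊤), hs', trivial⟩) ?_).tail (Or.inr ⟨le_rfl, le_top⟩)
        exact (le_total s s').imp (fun h => ⟨h, le_rfl⟩) fun h => ⟨h, le_rfl⟩ }
  cases := Or.inr (Or.inr (Or.inl ⟨J, hJ, rfl⟩))

theorem _root_.isBlock_horizontal {J : Set ℝ≥0∞} (hJ : IsInterval J) :
    IsBlock ((Set.univ : Set ℝ≥0∞) ×ˢ J) where
  isInterval :=
    { convex := fun _ _ _ hx hy hxz hzy => ⟨trivial, hJ.convex hx.2 hy.2 hxz.2 hzy.2⟩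
      connected := by
        rintro ⟨⟨s, t⟩, hs, ht⟩ ⟨⟨s', t'⟩, hs', ht'⟩
        refine ((Relation.ReflTransGen.single (b := (⟨(⊤, t), trivial, ht⟩ : ↥(Set.univ ×ˢ J)))
          (Or.inl ⟨le_top, le_rfl⟩)).tail (b := ⟨(⊤, t), trivial, ht⟩)
          (c := ⟨(⊤, t'), trivial, ht'⟩) ?_).tail (Or.inr ⟨le_top, le_rfl⟩)
        exact (le_total t t').imp (fun h => ⟨le_rfl, h⟩) fun h => ⟨le_rfl, h⟩ }
  cases := Or.inr (Or.inr (Or.inr ⟨J, hJ, rfl⟩))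

/-- A nonzero pointwise finite-dimensional middle-exact module has a block summand. -/
theorem exists_intervalSummand_block (hfin : IsPointwiseFiniteDimensional F)
    (hF : F.HasMiddleLifts) (p : ℝ≥0∞ × ℝ≥0∞) [Nontrivial (F.space p)] :
    ∃ G : IntervalSummand F, IsBlock G.support ∧ G.support.Nonempty := by
  -- Once both corners vanish, `HasMiddleLifts.eq_zero` forces `F (s, ⊤)` or `F (⊤, t)` to be
  -- nonzero.
  rcases subsingleton_or_nontrivial (F.space (⊥, ⊥)) with hbot | hbot
  · rcases subsingleton_or_nontrivial (F.space (⊤, ⊤)) with htop | htop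
    · obtain ⟨s, t⟩ := p
      rcases subsingleton_or_nontrivial (F.space (s, ⊤)) with hs | hs
      · rcases subsingleton_or_nontrivial (F.space (⊤, t)) with ht | ht
        · obtain ⟨x, hx⟩ := exists_ne (0 : F.space (s, t))
          exact absurd (hF.eq_zero (Subsingleton.elim _ _) (Subsingleton.elim _ _)) hx
        · obtain ⟨G, J, hJ, ht, hG⟩ := hF.exists_horizontal hfin t
          exact ⟨G, hG ▸ isBlock_horizontal hJ, hG ▸ ⟨(⊤, t), trivial, ht⟩⟩
      · obtain ⟨G, J, hJ, hs, hG⟩ := hF.exists_vertical hfin s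
        exact ⟨G, hG ▸ isBlock_vertical hJ, hG ▸ ⟨(s, ⊤), hs, trivial⟩⟩
    · obtain ⟨G, J₁, J₂, h₁, h₂, hG, hmem⟩ := exists_intervalSummand_birth hfin hF
      exact ⟨G, hG ▸ isBlock_birth h₁ h₂, _, hmem⟩
  · obtain ⟨G, J₁, J₂, h₁, h₂, hG, hmem⟩ := exists_intervalSummand_death hfin hF
    exact ⟨G, hG ▸ isBlock_death h₁ h₂, _, hmem⟩

end Block

end PersistenceModule

/-! ### Orthogonal families and a maximal one. -/

namespace PersistenceModule

section Family

variable {K : Type u} [Field K] {P : Type} [PartialOrder P] {F : PersistenceModule K P}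

/-- A family of interval summands is orthogonal if the functionals of each one vanish on the
vectors of all the others. -/
def IsOrthogonalFamily (𝒮 : Set (IntervalSummand F)) : Prop :=
  𝒮.Pairwise fun G H => ∀ p, G.coord p (H.gen p) = 0

/-- Applying `G.coord p` to a relation isolates the coefficient of `G`. Consequently only finitely
many members of the family are supported at a given point. -/
theorem IsOrthogonalFamily.linearIndependent {𝒮 : Set (IntervalSummand F)}
    (h𝒮 : IsOrthogonalFamily 𝒮) (p : P) :
    LinearIndependent K
      (fun G : {G : IntervalSummand F // G ∈ 𝒮 ∧ p ∈ G.support} => G.1.gen p) := by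
  classical
  rw [linearIndependent_iff']
  intro s g hg G hG
  have h := congrArg (G.1.coord p) hg
  rw [map_sum, map_zero, Finset.sum_eq_single G] at h
  · simpa [G.1.coord_gen p G.2.2] using h
  · intro H _ hH
    rw [map_smul, h𝒮 G.2.1 H.2.1 (fun h => hH (Subtype.ext h.symm)) p, smul_zero]
  · exact fun h => absurd hG h

theorem IsOrthogonalFamily.finite {𝒮 : Set (IntervalSummand F)} (h𝒮 : IsOrthogonalFamily 𝒮)
    (hfin : IsPointwiseFiniteDimensional F) (p : P) :
    {G : IntervalSummand F | G ∈ 𝒮 ∧ p ∈ G.support}.Finite := by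
  have := hfin p
  exact Set.finite_coe_iff.1 (h𝒮.linearIndependent p).finite

/-- The projection onto the complement of an orthogonal family of interval summands. -/
theorem IsOrthogonalFamily.exists_projection {𝒮 : Set (IntervalSummand F)}
    (h𝒮 : IsOrthogonalFamily 𝒮) (hfin : IsPointwiseFiniteDimensional F) :
    ∃ π : ∀ p, F.obj p →ₗ[K] F.obj p,
      (∀ p q (h : p ≤ q) x, F.transition h (π p x) = π q (F.transition h x)) ∧
      (∀ p x, π p (π p x) = π p x) ∧
      (∀ G ∈ 𝒮, ∀ p x, G.coord p (π p x) = 0) ∧ (∀ G ∈ 𝒮, ∀ p, π p (G.gen p) = 0) ∧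
      ∀ p x, π p x = 0 → x ∈ Submodule.span K
        (Set.range fun G : {G : IntervalSummand F // G ∈ 𝒮 ∧ p ∈ G.support} => G.1.gen p) := by
  classical
  let T (p : P) : Finset (IntervalSummand F) := (h𝒮.finite hfin p).toFinset
  have hT : ∀ p G, G ∈ T p ↔ G ∈ 𝒮 ∧ p ∈ G.support := fun p G => Set.Finite.mem_toFinset _
  let π (p : P) : F.obj p →ₗ[K] F.obj p :=
    LinearMap.id - ∑ G ∈ T p, (G.coord p).smulRight (G.gen p)
  have hπ : ∀ p x, π p x = x - ∑ G ∈ T p, G.coord p x • G.gen p := by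
    intro p x
    simp [π, LinearMap.sum_apply]
  have hcoord : ∀ G ∈ 𝒮, ∀ p x, G.coord p (π p x) = 0 := by
    intro G hG p x
    by_cases hp : p ∈ G.support
    · rw [hπ, map_sub, map_sum, Finset.sum_eq_single G, map_smul, G.coord_gen p hp, smul_eq_mul,
        mul_one, sub_self]
      · intro H hH hne
        rw [map_smul, h𝒮 hG ((hT p H).1 hH).1 hne.symm p, smul_zero]
      · exact fun h => absurd ((hT p G).2 ⟨hG, hp⟩) h
    · rw [G.coord_eq_zero p hp, LinearMap.zero_apply]
  refine ⟨π, ?_, ?_, hcoord, ?_, ?_⟩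
  · intro p q h x
    -- The index sets at `p` and `q` differ; over their union the sums compare term by term, as the
    -- added terms have zero vectors.
    have hp : ∑ G ∈ T p, G.coord p x • G.gen p = ∑ G ∈ T p ∪ T q, G.coord p x • G.gen p := by
      refine Finset.sum_subset Finset.subset_union_left fun G hG hG' => ?_
      have hGS : G ∈ 𝒮 := (Finset.mem_union.1 hG).elim (fun h => ((hT _ _).1 h).1)
        fun h => ((hT _ _).1 h).1
      rw [G.gen_eq_zero p fun h => hG' ((hT p G).2 ⟨hGS, h⟩), smul_zero]
    have hq : ∑ G ∈ T q, G.coord q (F.transition h x) • G.gen q =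
        ∑ G ∈ T p ∪ T q, G.coord q (F.transition h x) • G.gen q := by
      refine Finset.sum_subset Finset.subset_union_right fun G hG hG' => ?_
      have hGS : G ∈ 𝒮 := (Finset.mem_union.1 hG).elim (fun h => ((hT _ _).1 h).1)
        fun h => ((hT _ _).1 h).1
      rw [G.gen_eq_zero q fun h => hG' ((hT q G).2 ⟨hGS, h⟩), smul_zero]
    rw [hπ, hπ, map_sub, hp, hq, map_sum]
    congr 1
    refine Finset.sum_congr rfl fun G _ => ?_
    rw [map_smul]
    by_cases h₁ : p ∈ G.support
    · rw [G.map_gen p q h h₁]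
      by_cases h₂ : q ∈ G.support
      · rw [G.coord_map p q h h₂]
      · rw [G.gen_eq_zero q h₂, smul_zero, smul_zero]
    · rw [G.gen_eq_zero p h₁, map_zero, smul_zero]
      by_cases h₂ : q ∈ G.support
      · rw [G.coord_map p q h h₂, G.coord_eq_zero p h₁, LinearMap.zero_apply, zero_smul]
      · rw [G.gen_eq_zero q h₂, smul_zero]
  · intro p x
    rw [hπ p (π p x), Finset.sum_eq_zero, sub_zero]
    intro G hG
    rw [hcoord G ((hT p G).1 hG).1, zero_smul]
  · intro G hG p
    by_cases hp : p ∈ G.support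
    · rw [hπ, Finset.sum_eq_single G, G.coord_gen p hp, one_smul, sub_self]
      · intro H hH hne
        rw [h𝒮 ((hT p H).1 hH).1 hG hne p, zero_smul]
      · exact fun h => absurd ((hT p G).2 ⟨hG, hp⟩) h
    · rw [G.gen_eq_zero p hp, map_zero]
  · intro p x hx
    rw [hπ, sub_eq_zero] at hx
    rw [hx]
    exact Submodule.sum_mem _ fun G hG =>
      Submodule.smul_mem _ _ (Submodule.subset_span ⟨⟨G, (hT p G).1 hG⟩, rfl⟩)

/-- If every nonzero natural idempotent endomorphism of `F` dominates an interval summand with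
support in a given class, then `F` is spanned by an orthogonal family of such summands. -/
theorem exists_isOrthogonalFamily_span_eq_top (hfin : IsPointwiseFiniteDimensional F)
    (𝒬 : Set P → Prop)
    (step : ∀ π : ∀ p, F.obj p →ₗ[K] F.obj p,
      (∀ p q (h : p ≤ q) x, F.transition h (π p x) = π q (F.transition h x)) →
      (∀ p x, π p (π p x) = π p x) → (∃ p x, π p x ≠ 0) →
      ∃ G : IntervalSummand F, 𝒬 G.support ∧ G.support.Nonempty ∧
        (∀ p, π p (G.gen p) = G.gen p) ∧ ∀ p x, G.coord p (π p x) = G.coord p x) :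
    ∃ 𝒮 : Set (IntervalSummand F), IsOrthogonalFamily 𝒮 ∧
      (∀ G ∈ 𝒮, 𝒬 G.support ∧ G.support.Nonempty) ∧
      ∀ p, Submodule.span K
        (Set.range fun G : {G : IntervalSummand F // G ∈ 𝒮 ∧ p ∈ G.support} => G.1.gen p) = ⊤ := by
  obtain ⟨𝒮, h𝒮⟩ := zorn_subset {𝒮 : Set (IntervalSummand F) | IsOrthogonalFamily 𝒮 ∧
    ∀ G ∈ 𝒮, 𝒬 G.support ∧ G.support.Nonempty} (by
      intro c hc hchain
      refine ⟨⋃₀ c, ⟨?_, ?_⟩, fun s hs => Set.subset_sUnion_of_mem hs⟩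
      · exact (Set.pairwise_sUnion hchain.directedOn).2 fun s hs => (hc hs).1
      · rintro G ⟨s, hs, hG⟩
        exact (hc hs).2 G hG)
  obtain ⟨horth, hsupp⟩ := h𝒮.prop
  refine ⟨𝒮, horth, hsupp, fun p => ?_⟩
  obtain ⟨π, hnat, hidem, hcoord, hgen, hspan⟩ := horth.exists_projection hfin
  refine Submodule.eq_top_iff'.2 fun x => hspan p x (by_contra fun hx => ?_)
  obtain ⟨G, hG𝒬, ⟨q, hq⟩, hG₁, hG₂⟩ := step π hnat hidem ⟨p, x, hx⟩
  -- A summand of the complement is orthogonal to the family, so by maximality it already belongs to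
  -- it. Its functional then vanishes on the image of `π`, which contains its own vectors.
  have hmem : G ∈ 𝒮 := by
    refine h𝒮.le_of_ge (y := insert G 𝒮) ⟨?_, ?_⟩ (Set.subset_insert _ _) (Set.mem_insert _ _)
    · refine horth.insert fun H hH _ => ⟨fun r => ?_, fun r => ?_⟩
      · rw [← hG₂, hgen H hH, map_zero]
      · rw [← hG₁, hcoord H hH]
    · rintro H (rfl | hH)
      · exact ⟨hG𝒬, q, hq⟩
      · exact hsupp H hH
  have h := G.coord_gen q hq
  rw [← hG₁, hcoord G hmem] at h
  exact zero_ne_one h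

end Family

/-! ### Images of natural idempotents. -/

section Retract

variable {K : Type u} [Field K] {P : Type} [PartialOrder P] (F : PersistenceModule K P)

/-- The submodule of a persistence module given by a compatible family of subspaces. -/
def restrict (N : ∀ p, Submodule K (F.obj p))
    (hN : ∀ p q (h : p ≤ q), ∀ x ∈ N p, F.transition h x ∈ N q) : PersistenceModule K P where
  obj p := ModuleCat.of K (N p)
  map f := ModuleCat.ofHom ((F.transition (leOfHom f)).restrict (hN _ _ (leOfHom f)))
  map_id _ := ModuleCat.hom_ext (LinearMap.ext fun x => Subtype.ext (F.transition_refl le_rfl x.1))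
  map_comp f g := ModuleCat.hom_ext (LinearMap.ext fun x =>
    Subtype.ext (F.transition_transition (leOfHom f) (leOfHom g) x.1).symm)

/-- An interval summand of the image of a natural idempotent is an interval summand of `F`. -/
theorem exists_intervalSummand_of_idempotent (π : ∀ p, F.obj p →ₗ[K] F.obj p)
    (hnat : ∀ p q (h : p ≤ q) x, F.transition h (π p x) = π q (F.transition h x))
    (hidem : ∀ p x, π p (π p x) = π p x)
    (hN : ∀ p q (h : p ≤ q), ∀ x ∈ LinearMap.range (π p),
      F.transition h x ∈ LinearMap.range (π q))
    (G : IntervalSummand (F.restrict (fun p => LinearMap.range (π p)) hN)) :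
    ∃ G' : IntervalSummand F, G'.support = G.support ∧ (∀ p, π p (G'.gen p) = G'.gen p) ∧
      ∀ p x, G'.coord p (π p x) = G'.coord p x := by
  obtain ⟨J, g, c, hJ, hg₀, hc₀, hcg, hg, hc⟩ : ∃ (J : Set P) (g : ∀ p, LinearMap.range (π p))
      (c : ∀ p, Module.Dual K (LinearMap.range (π p))), J = G.support ∧ (∀ p ∉ J, g p = 0) ∧
        (∀ p ∉ J, c p = 0) ∧ (∀ p ∈ J, c p (g p) = 1) ∧
        (∀ p q (h : p ≤ q), p ∈ J →
          (F.transition h).restrict (hN p q h) (g p) = g q) ∧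
        ∀ p q (h : p ≤ q), q ∈ J → ∀ x, c q ((F.transition h).restrict (hN p q h) x) = c p x :=
    ⟨G.support, G.gen, G.coord, rfl, G.gen_eq_zero, G.coord_eq_zero, G.coord_gen, G.map_gen,
      G.coord_map⟩
  have hπg : ∀ p, π p (g p) = g p := by
    intro p
    obtain ⟨x, hx⟩ := (g p).2
    rw [← hx, hidem]
  refine ⟨⟨J, fun p => g p, fun p => c p ∘ₗ (π p).rangeRestrict, ?_, ?_, ?_, ?_, ?_⟩, hJ, hπg, ?_⟩
  · intro p hp
    rw [hg₀ p hp, Submodule.coe_zero]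
  · intro p hp
    rw [hc₀ p hp, LinearMap.zero_comp]
  · intro p hp
    rw [LinearMap.comp_apply, show (π p).rangeRestrict (g p : F.obj p) = g p from
      Subtype.ext (hπg p), hcg p hp]
  · intro p q h hp
    exact congrArg Subtype.val (hg p q h hp)
  · intro p q h hq x
    rw [LinearMap.comp_apply, LinearMap.comp_apply, ← hc p q h hq]
    exact congrArg (c q) (Subtype.ext (hnat p q h x).symm)
  · intro p x
    exact congrArg (c p) (Subtype.ext (hidem p x))

end Retract

/-- A lift in `F` need not lie in the image of `π`, but applying `π` puts it there and, by
naturality, keeps it a lift because `π` fixes the given pair. -/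
theorem HasMiddleLifts.restrict_range {K : Type u} [Field K] {S T : Type} [LinearOrder S]
    [LinearOrder T] {F : PersistenceModule K (S × T)} (hF : F.HasMiddleLifts)
    (π : ∀ p, F.space p →ₗ[K] F.space p)
    (hnat : ∀ p q (h : p ≤ q) x, F.transition h (π p x) = π q (F.transition h x))
    (hidem : ∀ p x, π p (π p x) = π p x)
    (hN : ∀ p q (h : p ≤ q), ∀ x ∈ LinearMap.range (π p),
      F.transition h x ∈ LinearMap.range (π q)) :
    (F.restrict (fun p => LinearMap.range (π p)) hN).HasMiddleLifts := by
  rintro s s' t t' hs ht ⟨_, a, rfl⟩ ⟨_, b, rfl⟩ hab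
  obtain ⟨c, hc₁, hc₂⟩ := hF s s' t t' hs ht _ _ (congrArg Subtype.val hab)
  refine ⟨⟨π _ c, c, rfl⟩, Subtype.ext ?_, Subtype.ext ?_⟩
  · refine (hnat _ _ _ _).trans ?_
    exact (congrArg _ hc₁).trans (hidem _ a)
  · refine (hnat _ _ _ _).trans ?_
    exact (congrArg _ hc₂).trans (hidem _ b)

end PersistenceModule

/-! ### Maps out of interval modules. -/

noncomputable section IntervalModule

variable {K : Type u} [Field K] {P : Type} [PartialOrder P] {I : Set P} (hI : IsInterval I)

/-- An interval module takes the value `K` on the interval. -/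
def intervalModuleIso {p : P} (hp : p ∈ I) : ModuleCat.of K K ≅ (intervalModule K hI).obj p :=
  eqToIso (if_pos hp).symm

/-- The generator of an interval module at a point of the interval. -/
def intervalModuleOne {p : P} (hp : p ∈ I) : (intervalModule K hI).obj p :=
  (intervalModuleIso hI hp).hom.hom (1 : K)

theorem isZero_intervalModule_obj {p : P} (hp : p ∉ I) : IsZero ((intervalModule K hI).obj p) := by
  unfold intervalModule
  simp only [if_neg hp]
  exact ModuleCat.isZero_of_subsingleton _

theorem intervalModule_hom_ext {p : P} {X : ModuleCat.{u} K} {f g : (intervalModule K hI).obj p ⟶ X}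
    (h : ∀ hp : p ∈ I, f.hom (intervalModuleOne hI hp) = g.hom (intervalModuleOne hI hp)) :
    f = g := by
  by_cases hp : p ∈ I
  · rw [← cancel_epi (intervalModuleIso hI hp).hom]
    exact ModuleCat.hom_ext (LinearMap.ext_ring (h hp))
  · exact (isZero_intervalModule_obj hI hp).eq_of_src _ _

theorem intervalModule_map_one {p q : P} (h : p ≤ q) (hp : p ∈ I) (hq : q ∈ I) :
    (intervalModule K hI).transition h (intervalModuleOne hI hp) = intervalModuleOne hI hq := by
  have h' : (intervalModule K hI).map (homOfLE h) =
      (intervalModuleIso hI hp).inv ≫ (intervalModuleIso hI hq).hom :=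
    (dif_pos ⟨hp, hq⟩).trans (congrArg _ (Category.id_comp _))
  rw [Iso.eq_inv_comp] at h'
  exact congrArg (fun k => k.hom (1 : K)) h'

/-- The map from an interval module given by a compatible family of vectors. -/
theorem exists_intervalModule_hom (F : PersistenceModule K P) (v : ∀ p, F.obj p)
    (hv₀ : ∀ p ∉ I, v p = 0) (hv : ∀ p q (h : p ≤ q), p ∈ I → F.transition h (v p) = v q) :
    ∃ f : intervalModule K hI ⟶ F, ∀ p (hp : p ∈ I),
      (f.app p).hom (intervalModuleOne hI hp) = v p := by
  classical
  let f (p : P) : (intervalModule K hI).obj p ⟶ F.obj p :=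
    if hp : p ∈ I then (intervalModuleIso hI hp).inv ≫
      ModuleCat.ofHom (LinearMap.toSpanSingleton K _ (v p))
    else 0
  have hf : ∀ p (hp : p ∈ I), (f p).hom (intervalModuleOne hI hp) = v p := by
    intro p hp
    have h' : (intervalModuleIso hI hp).hom ≫ f p =
        ModuleCat.ofHom (LinearMap.toSpanSingleton K _ (v p)) := by
      simp [f, hp]
    refine (congrArg (fun k => k.hom (1 : K)) h').trans ?_
    simp
  refine ⟨⟨f, fun p q g => intervalModule_hom_ext hI fun hp => ?_⟩, hf⟩
  have hg : g = homOfLE (leOfHom g) := rfl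
  change (f q).hom ((intervalModule K hI).transition (leOfHom g) (intervalModuleOne hI hp)) =
    F.transition (leOfHom g) ((f p).hom (intervalModuleOne hI hp))
  rw [hf p hp, hv _ _ _ hp]
  by_cases hq : q ∈ I
  · rw [intervalModule_map_one hI _ hp hq, hf q hq]
  · rw [(isZero_intervalModule_obj hI hq).eq_of_src (f q) 0, hv₀ q hq]
    rfl

end IntervalModule

/-! ### From pointwise bases to a coproduct. -/

namespace PersistenceModule

section Decomposition

variable {K : Type u} [Field K] {P : Type} [PartialOrder P] {F : PersistenceModule K P}

/-- A family of interval summands whose vectors form a basis at every point exhibits `F` as a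
coproduct of interval modules. -/
theorem nonempty_iso_coproduct {ι : Type} (G : ι → IntervalSummand F)
    (hG : ∀ i, IsInterval (G i).support)
    (b : ∀ p, Module.Basis {i // p ∈ (G i).support} K (F.obj p)) (hb : ∀ p i, b p i = (G i).gen p) :
    Nonempty (F ≅ ∐ fun i : ι => intervalModule K (hG i)) := by
  choose f hf using fun i =>
    exists_intervalModule_hom (hG i) F (G i).gen (G i).gen_eq_zero (G i).map_gen
  -- The basis at `p` prescribes the map to any other cofan; naturality and uniqueness need checking
  -- on basis vectors only.
  let d (s : Cofan fun i : ι => intervalModule K (hG i)) (p : P) : F.obj p →ₗ[K] s.pt.obj p :=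
    (b p).constr K fun i => ((s.inj i).app p).hom (intervalModuleOne (hG i) i.2)
  have hd : ∀ s p (i : {i // p ∈ (G i).support}), d s p ((G i).gen p) =
      ((s.inj i).app p).hom (intervalModuleOne (hG i) i.2) := by
    intro s p i
    rw [← hb, Module.Basis.constr_basis]
  let c : Cofan fun i : ι => intervalModule K (hG i) := Cofan.mk F f
  have hc : IsColimit c := by
    refine Cofan.IsColimit.mk c (fun s => ⟨fun p => ModuleCat.ofHom (d s p), fun p q g => ?_⟩) ?_ ?_
    · refine ModuleCat.hom_ext ((b p).ext fun i => ?_)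
      rw [hb]
      change d s q (F.transition (leOfHom g) ((G i).gen p)) =
        transition s.pt (leOfHom g) (d s p ((G i).gen p))
      have hn : transition s.pt (leOfHom g)
          (((s.inj i.1).app p).hom (intervalModuleOne (hG i) i.2)) =
          ((s.inj i.1).app q).hom ((intervalModule K (hG i)).transition (leOfHom g)
            (intervalModuleOne (hG i) i.2)) :=
        (congrArg (fun k => k.hom (intervalModuleOne (hG i) i.2)) ((s.inj i.1).naturality g)).symm
      rw [(G i).map_gen _ _ _ i.2, hd, hn]
      by_cases hq : q ∈ (G i).support
      · rw [intervalModule_map_one _ _ i.2 hq]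
        exact hd s q ⟨i, hq⟩
      · rw [(G i).gen_eq_zero q hq, map_zero,
          (isZero_intervalModule_obj (hG i) hq).eq_of_src ((s.inj i.1).app q) 0]
        rfl
    · intro s i
      ext p : 2
      refine intervalModule_hom_ext _ fun hp => ?_
      change d s p (((f i).app p).hom _) = _
      rw [hf i p hp]
      exact hd s p ⟨i, hp⟩
    · intro s m hm
      ext p : 2
      refine ModuleCat.hom_ext ((b p).ext fun i => ?_)
      rw [hb]
      refine Eq.trans ?_ (hd s p i).symm
      rw [← hf i p i.2]
      exact congrArg (fun k => (k.app p).hom (intervalModuleOne (hG i) i.2)) (hm i.1)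
  exact ⟨hc.coconePointUniqueUpToIso (colimit.isColimit _)⟩

/-- An orthogonal spanning family of interval summands decomposes `F`. -/
theorem IsOrthogonalFamily.exists_iso_coproduct {𝒮 : Set (IntervalSummand F)}
    (h𝒮 : IsOrthogonalFamily 𝒮) (hfin : IsPointwiseFiniteDimensional F)
    (𝒬 : Set P → Prop) (h𝒬 : ∀ I, 𝒬 I → IsInterval I)
    (hsupp : ∀ G ∈ 𝒮, 𝒬 G.support ∧ G.support.Nonempty)
    (hspan : ∀ p, Submodule.span K
      (Set.range fun G : {G : IntervalSummand F // G ∈ 𝒮 ∧ p ∈ G.support} => G.1.gen p) = ⊤) :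
    ∃ (ι : Type) (B : ι → Set P) (hB : ∀ i, 𝒬 (B i)),
      Nonempty (F ≅ ∐ fun i : ι => intervalModule K (h𝒬 _ (hB i))) := by
  -- Every support is nonempty, so the family is a union of finite sets indexed by `P : Type`; it
  -- can be reindexed by a type in the lowest universe.
  have hsmall : Small.{0} 𝒮 := by
    have (p : P) : Small.{0} {G : IntervalSummand F | G ∈ 𝒮 ∧ p ∈ G.support} :=
      have := (h𝒮.finite hfin p).to_subtype
      inferInstance
    refine small_subset (s := ⋃ p, {G : IntervalSummand F | G ∈ 𝒮 ∧ p ∈ G.support}) fun G hG => ?_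
    obtain ⟨p, hp⟩ := (hsupp G hG).2
    exact Set.mem_iUnion.2 ⟨p, hG, hp⟩
  let e := (equivShrink.{0} 𝒮).symm
  let G (i : Shrink.{0} 𝒮) : IntervalSummand F := (e i).1
  let b (p : P) : Module.Basis {i // p ∈ (G i).support} K (F.obj p) :=
    (Module.Basis.mk (h𝒮.linearIndependent p) (hspan p).ge).reindex
      { toFun := fun H => ⟨e.symm ⟨H.1, H.2.1⟩, by simpa [G] using H.2.2⟩
        invFun := fun i => ⟨G i.1, (e i.1).2, i.2⟩
        left_inv := fun H => by simp [G]
        right_inv := fun i => by simp [G] }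
  exact ⟨Shrink.{0} 𝒮, fun i => (G i).support, fun i => (hsupp _ (e i).2).1,
    nonempty_iso_coproduct G (fun i => h𝒬 _ (hsupp _ (e i).2).1) b fun p i => by simp [b]⟩

end Decomposition

end PersistenceModule

theorem mainTheorem6 {K : Type u} [Field K]
    (F : PersistenceModule K (ℝ≥0∞ × ℝ≥0∞))
    (hfin : IsPointwiseFiniteDimensional F) (hF : IsMiddleExact F) :
    ∃ (ι : Type) (B : ι → Set (ℝ≥0∞ × ℝ≥0∞)) (hB : ∀ i, IsBlock (B i)),
      Nonempty (F ≅ ∐ fun i : ι => intervalModule K (hB i).isInterval) := by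
  obtain ⟨𝒮, h𝒮, hsupp, hspan⟩ := PersistenceModule.exists_isOrthogonalFamily_span_eq_top hfin
    IsBlock (by
      rintro π hnat hidem ⟨p, x, hx⟩
      have hN : ∀ p q (h : p ≤ q), ∀ x ∈ LinearMap.range (π p),
          F.transition h x ∈ LinearMap.range (π q) := by
        rintro p q h _ ⟨x, rfl⟩
        exact ⟨F.transition h x, (hnat p q h x).symm⟩
      have hfin' : IsPointwiseFiniteDimensional
          (F.restrict (fun p => LinearMap.range (π p)) hN) := fun p =>
        have := hfin p
        inferInstanceAs (FiniteDimensional K (LinearMap.range (π p)))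
      have hnt : Nontrivial ((F.restrict (fun p => LinearMap.range (π p)) hN).space p) :=
        ⟨⟨⟨π p x, x, rfl⟩, 0, fun h => hx (congrArg Subtype.val h)⟩⟩
      obtain ⟨G, hG, hne⟩ := PersistenceModule.exists_intervalSummand_block hfin'
        (hF.hasMiddleLifts.restrict_range π hnat hidem hN) p
      obtain ⟨G', hG', h₁, h₂⟩ :=
        PersistenceModule.exists_intervalSummand_of_idempotent F π hnat hidem hN G
      exact ⟨G', hG' ▸ hG, hG' ▸ hne, h₁, h₂⟩)
  exact h𝒮.exists_iso_coproduct hfin IsBlock (fun _ h => h.isInterval) hsupp hspan
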